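/- Let $d\ge 1$, and equip $\mathbb{R}^d$ with the Euclidean norm; $B(x,\rho)$ denotes the closed ball of radius $\rho$ centred at $x$, and for an affine subspace $\mathcal L$ let $\mathcal L^{(\varepsilon)}=\{x\in\mathbb{R}^d:\operatorname{dist}(x,\mathcal L)\le\varepsilon\}$. For an integer $0\le k<d$ and $0<\beta<1$, a closed set $K\subset\mathbb{R}^d$ is called *$k$-dimensionally $\beta$-diffuse* if there exists $\rho_K>0$ such that for every $0<\rho\le\rho_K$, every $x\in K$ and every $k$-dimensional affine subspace $\mathcal L\subset\mathbb{R}^d$ we have $K\cap B(x,\rho)\setminus\mathcal L^{(\beta\rho)}\neq\varnothing$. For $0<\alpha,\gamma<1$, consider the game in which Bob and Alice alternately choose closed balls $B_1\supset A_1\supset B_2\supset A_2\supset\cdots$ in $\mathbb{R}^d$, all centred at points of $K$, where Bob's first ball $B_1$ has arbitrary positive radius and the radii satisfy $\rho(A_i)=\alpha\rho(B_i)$ and $\rho(B_{i+1})=\gamma\rho(A_i)$ for all $i\ge 1$. A set $S\subset\mathbb{R}^d$ is *$(\alpha,\gamma)$-winning on $K$* if Alice has a strategy guaranteeing that the unique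 point of $\bigcap_i B_i$ belongs to $S$ however Bob plays, and *winning on $K$* if there is $\alpha\in(0,1)$ such that $S$ is $(\alpha,\gamma)$-winning on $K$ for every $\gamma\in(0,1)$. **Theorem.** Let $0\le k<d$ and $0<\beta<1$, let $K\subset\mathbb{R}^d$ be $k$-dimensionally $\beta$-diffuse, let $S\subset\mathbb{R}^d$ be winning on $K$, and let $U\subset\mathbb{R}^d$ be an open set with $U\cap K\neq\varnothing$. Then $$\dim(S\cap K\cap U)\ \ge\ \frac{-\log(k+2)}{\log\beta-\log(2+\beta)},$$ where $\dim$ denotes Hausdorff dimension. -/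

import Mathlib

/-- A closed set `K ⊆ ℝ^d` is `k`-dimensionally `β`-diffuse (for `0 ≤ k < d`, `0 < β < 1`) if there
is `ρK > 0` such that for all `0 < ρ ≤ ρK`, `x ∈ K` and every `k`-dimensional affine subspace `L`,
some point of `K` lies in the closed ball `B(x, ρ)` but outside the closed `βρ`-neighbourhood
of `L`. -/
structure IsDiffuse {d : ℕ} (k : ℕ) (β : ℝ) (K : Set (EuclideanSpace ℝ (Fin d))) : Prop where
  dim_lt : k < d
  pos : 0 < β
  lt_one : β < 1
  isClosed : IsClosed K
  exists_point : ∃ ρK : ℝ, 0 < ρK ∧ ∀ ρ : ℝ, 0 < ρ → ρ ≤ ρK → ∀ x ∈ K,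
    ∀ L : AffineSubspace ℝ (EuclideanSpace ℝ (Fin d)),
      (L : Set (EuclideanSpace ℝ (Fin d))).Nonempty → Module.finrank ℝ L.direction = k →
        ∃ x' ∈ K, x' ∈ Metric.closedBall x ρ \
          Metric.cthickening (β * ρ) (L : Set (EuclideanSpace ℝ (Fin d)))

namespace SchmidtGame

/-- The data of a closed ball chosen by a player: its centre and its radius. -/
structure GameBall (d : ℕ) where
  center : EuclideanSpace ℝ (Fin d)
  radius : ℝ

/-- The closed ball in `ℝ^d` with the given centre and radius. -/
def GameBall.toSet {d : ℕ} (B : GameBall d) : Set (EuclideanSpace ℝ (Fin d)) :=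
  Metric.closedBall B.center B.radius

/-- A strategy for Alice: her answer to each finite list of Bob's balls played so far, in the order
of play. (Her own earlier moves are determined by the strategy and Bob's earlier moves.) -/
abbrev Strategy (d : ℕ) := List (GameBall d) → GameBall d

/-- Alice's `n`-th ball (counting from `0`) when she follows `σ` and Bob plays `b 0, b 1, …`. -/
def aliceBall {d : ℕ} (σ : Strategy d) (b : ℕ → GameBall d) (n : ℕ) : GameBall d :=
  σ ((List.range (n + 1)).map b)

/-- Bob's `n`-th ball is a legal move in the game on `K` against `σ`: it is centred on `K`; the
first ball has an arbitrary positive radius; each later ball is contained in Alice's previous ball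
and has `β` times its radius. -/
def BobLegal {d : ℕ} (K : Set (EuclideanSpace ℝ (Fin d))) (β : ℝ) (σ : Strategy d)
    (b : ℕ → GameBall d) : ℕ → Prop
  | 0 => (b 0).center ∈ K ∧ 0 < (b 0).radius
  | n + 1 => (b (n + 1)).center ∈ K ∧ (b (n + 1)).radius = β * (aliceBall σ b n).radius ∧
      (b (n + 1)).toSet ⊆ (aliceBall σ b n).toSet

/-- Alice's `n`-th ball is a legal move in the game on `K`: it is centred on `K`, contained in Bob's
`n`-th ball, and has `α` times its radius. -/
def AliceLegal {d : ℕ} (K : Set (EuclideanSpace ℝ (Fin d))) (α : ℝ) (σ : Strategy d)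
    (b : ℕ → GameBall d) (n : ℕ) : Prop :=
  (aliceBall σ b n).center ∈ K ∧ (aliceBall σ b n).radius = α * (b n).radius ∧
    (aliceBall σ b n).toSet ⊆ (b n).toSet

/-- `S` is `(α, β)`-winning on `K`: Alice has a strategy that answers legally as long as Bob has
played legally, and such that whenever Bob plays legally throughout, the unique common point of all
the balls belongs to `S`. -/
def IsWinningOnWith {d : ℕ} (α β : ℝ) (S K : Set (EuclideanSpace ℝ (Fin d))) : Prop :=
  ∃ σ : Strategy d, ∀ b : ℕ → GameBall d,
    (∀ n, (∀ i ≤ n, BobLegal K β σ b i) → AliceLegal K α σ b n) ∧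
    ((∀ n, BobLegal K β σ b n) → ∃ x ∈ S, ⋂ n, (b n).toSet = {x})

/-- `S` is winning on `K`: for some `0 < α < 1` it is `(α, β)`-winning on `K` for every
`0 < β < 1`. -/
def IsWinningOn {d : ℕ} (S K : Set (EuclideanSpace ℝ (Fin d))) : Prop :=
  ∃ α : ℝ, 0 < α ∧ α < 1 ∧ ∀ β : ℝ, 0 < β → β < 1 → IsWinningOnWith α β S K

end SchmidtGame

open Set Filter Topology

/-! Fix a winning strategy of Alice and let Bob's freedom of choice build a Cantor set of outcomes.
Put `c = β / (2 + β)`. In a small ball centred on `K`, points of `K` chosen greedily, each away from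
a `k`-plane through the earlier ones, give `k + 2` disjoint balls of relative radius `c`; iterating
gives `(k + 2) ^ n` of relative radius `c ^ n` (`IsDiffuse.exists_separated`). With `γ = c ^ n / 2`
Bob thus has `(k + 2) ^ n` well separated replies in every round, and the outcomes in `S ∩ K ∩ U`
have dimension at least `n log (k + 2) / (-n log c - log (α / 2))` (`IsWinningOnWith.le_dimH`, via
`le_dimH_range_of_separated`). As `α` does not depend on `γ`, its cost vanishes when `n → ∞`. -/

/-- Every subspace of dimension at most `k` is contained in one of dimension exactly `k`. -/
theorem Submodule.exists_le_finrank_eq {F V : Type*} [DivisionRing F] [AddCommGroup V] [Module F V]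
    [FiniteDimensional F V] (W : Submodule F V) {k : ℕ} (hWk : Module.finrank F W ≤ k)
    (hk : k ≤ Module.finrank F V) :
    ∃ W' : Submodule F V, W ≤ W' ∧ Module.finrank F W' = k := by
  induction k, hWk using Nat.le_induction with
  | base => exact ⟨W, le_rfl, rfl⟩
  | succ k _ ih =>
    obtain ⟨W', hWW', hW'⟩ := ih (by omega)
    obtain ⟨v, hv⟩ : ∃ v, v ∉ W' := by
      by_contra! h
      have : W' = ⊤ := Submodule.eq_top_iff'.2 h
      rw [this, finrank_top] at hW'
      omega
    refine ⟨W' ⊔ Submodule.span F {v}, hWW'.trans le_sup_left, ?_⟩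
    have hlt : W' < W' ⊔ Submodule.span F {v} :=
      lt_of_le_of_ne le_sup_left fun h => hv <| by
        rw [h]
        exact le_sup_right (a := W') (Submodule.mem_span_singleton_self v)
    have h₁ := Submodule.finrank_lt_finrank_of_lt hlt
    have h₂ := Submodule.finrank_add_le_finrank_add_finrank W' (Submodule.span F {v})
    have h₃ := finrank_span_le_card (R := F) ({v} : Set V)
    rw [Set.toFinset_singleton, Finset.card_singleton] at h₃
    omega

/-! ### Lower bounds for dimension from Hölder maps onto an interval -/

section Dimension

/-- A set parametrised by sequences of `N` symbols, such that sequences which first differ at place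
`n` give points at distance at least `c * θ ^ n`, has Hausdorff dimension at least
`log N / -log θ`. -/
theorem le_dimH_range_of_separated {X : Type*} [MetricSpace X] {N : ℕ} (hN : 1 < N)
    {θ c : ℝ} (hθ : 0 < θ) (hθ' : θ < 1) (hc : 0 < c) (x : (ℕ → Fin N) → X)
    (hx : ∀ u v : ℕ → Fin N, ∀ n, (∀ i < n, u i = v i) → u n ≠ v n →
      c * θ ^ n ≤ dist (x u) (x v)) :
    ENNReal.ofReal (Real.log N / -Real.log θ) ≤ dimH (range x) := by
  have hN' : (1 : ℝ) < N := by exact_mod_cast hN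
  have hlogN : 0 < Real.log N := Real.log_pos hN'
  have hlogθ : 0 < -Real.log θ := neg_pos.2 (Real.log_neg hθ hθ')
  set s : ℝ := Real.log N / -Real.log θ with hs
  have hs0 : 0 < s := div_pos hlogN hlogθ
  have hθs : θ ^ s = (N : ℝ)⁻¹ := by
    rw [Real.rpow_def_of_pos hθ, hs, ← Real.exp_log (inv_pos.2 (one_pos.trans hN')), Real.log_inv]
    have := hlogθ.ne
    congr 1
    grind
  have hfirst : ∀ u v : ℕ → Fin N, u ≠ v → ∃ n, (∀ i < n, u i = v i) ∧ u n ≠ v n := by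
    classical
    intro u v huv
    have h := Function.ne_iff.1 huv
    exact ⟨Nat.find h, fun i hi => not_not.1 (Nat.find_min h hi), Nat.find_spec h⟩
  have hinj : Function.Injective x := by
    intro u v huv
    by_contra hne
    obtain ⟨n, hlt, hn⟩ := hfirst u v hne
    have h := hx u v n hlt hn
    rw [huv, dist_self] at h
    exact absurd h (not_le.2 (by positivity))
  have : Nonempty (ℕ → Fin N) := ⟨fun _ => ⟨0, by omega⟩⟩
  -- Reading the symbols as base-`N` digits maps the set onto `[0, 1]`. Since `θ ^ s = 1 / N`, this
  -- map is `s`-Hölder, which forces dimension at least `s`.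
  let f : X → ℝ := fun y => Real.ofDigits (Function.invFun x y)
  have hf : ∀ u, f (x u) = Real.ofDigits u := fun u => by
    simp only [f, Function.leftInverse_invFun hinj u]
  have hholder : HolderOnWith (c ^ (-s)).toNNReal s.toNNReal f (range x) := by
    rintro _ ⟨u, rfl⟩ _ ⟨v, rfl⟩
    rcases eq_or_ne u v with rfl | huv
    · simp
    obtain ⟨n, hlt, hn⟩ := hfirst u v huv
    have hd := hx u v n hlt hn
    have key : dist (f (x u)) (f (x v)) ≤ c ^ (-s) * dist (x u) (x v) ^ s := by
      rw [hf, hf, Real.dist_eq]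
      calc |Real.ofDigits u - Real.ofDigits v| ≤ ((N : ℝ) ^ n)⁻¹ :=
            Real.abs_ofDigits_sub_ofDigits_le hlt
        _ = c ^ (-s) * (c * θ ^ n) ^ s := by
          rw [Real.mul_rpow hc.le (by positivity), ← mul_assoc, ← Real.rpow_add hc, neg_add_cancel,
            Real.rpow_zero, one_mul, ← Real.rpow_natCast θ, ← Real.rpow_mul hθ.le, mul_comm (n : ℝ) s,
            Real.rpow_mul hθ.le, hθs, Real.rpow_natCast, inv_pow]
        _ ≤ c ^ (-s) * dist (x u) (x v) ^ s := by gcongr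
    rw [edist_dist, edist_dist, Real.coe_toNNReal s hs0.le,
      ENNReal.ofReal_rpow_of_nonneg dist_nonneg hs0.le]
    change _ ≤ ENNReal.ofReal _ * _
    rw [← ENNReal.ofReal_mul (by positivity)]
    exact ENNReal.ofReal_le_ofReal key
  have himage : Icc (0 : ℝ) 1 ⊆ f '' range x := by
    intro y hy
    obtain ⟨u, -, rfl⟩ := Real.ofDigits_SurjOn hN hy
    exact ⟨x u, mem_range_self u, hf u⟩
  have hone : (1 : ENNReal) ≤ dimH (range x) / s.toNNReal := by
    calc (1 : ENNReal) = dimH (Icc (0 : ℝ) 1) := by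
          rw [Real.dimH_of_nonempty_interior (by simp [interior_Icc])]
          simp
      _ ≤ dimH (f '' range x) := dimH_mono himage
      _ ≤ _ := hholder.dimH_image_le (Real.toNNReal_pos.2 hs0)
  have hs1 : ENNReal.ofReal s ≠ 0 := by simpa using hs0
  simpa using (ENNReal.le_div_iff_mul_le (Or.inl hs1) (Or.inl ENNReal.ofReal_ne_top)).1 hone

end Dimension

/-! ### Separated points in diffuse sets -/

section Separated

variable {d k : ℕ} {β : ℝ} {K : Set (EuclideanSpace ℝ (Fin d))}

/-- If a ball in `K` is never covered by the `β ρ`-neighbourhood of a `k`-dimensional affine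
subspace, then it contains `j + 1 ≤ k + 2` points of `K` that are more than `β ρ` apart. -/
theorem exists_separated_of_diffuse (hkd : k < d) {ρ : ℝ} (hρ : 0 ≤ ρ)
    {x : EuclideanSpace ℝ (Fin d)} (hx : x ∈ K)
    (h : ∀ L : AffineSubspace ℝ (EuclideanSpace ℝ (Fin d)),
      (L : Set (EuclideanSpace ℝ (Fin d))).Nonempty → Module.finrank ℝ L.direction = k →
        ∃ x' ∈ K, x' ∈ Metric.closedBall x ρ \
          Metric.cthickening (β * ρ) (L : Set (EuclideanSpace ℝ (Fin d))))
    {j : ℕ} (hj : j ≤ k + 1) :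
    ∃ p : Fin (j + 1) → EuclideanSpace ℝ (Fin d), (∀ i, p i ∈ K) ∧ (∀ i, dist (p i) x ≤ ρ) ∧
      ∀ i i', i ≠ i' → β * ρ < dist (p i) (p i') := by
  induction j with
  | zero => exact ⟨fun _ => x, fun _ => hx, fun _ => by simpa using hρ,
      fun i i' hii' => absurd (Subsingleton.elim (α := Fin 1) i i') hii'⟩
  | succ j ih =>
    obtain ⟨p, hpK, hpx, hp⟩ := ih (by omega)
    -- At most `k + 1` points span dimension at most `k`; the span is enlarged because diffuseness
    -- speaks of dimension exactly `k`.
    have hrank : Module.finrank ℝ (vectorSpan ℝ (range p)) ≤ k :=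
      (finrank_vectorSpan_range_le ℝ p (Fintype.card_fin _)).trans (by omega)
    obtain ⟨W, hW, hWk⟩ := Submodule.exists_le_finrank_eq _ hrank (by simpa using hkd.le)
    obtain ⟨y, hyK, hyx, hy⟩ := h (AffineSubspace.mk' (p 0) W)
      ⟨p 0, AffineSubspace.self_mem_mk' _ _⟩ (by rwa [AffineSubspace.direction_mk'])
    have hfar : ∀ i, β * ρ < dist y (p i) := by
      intro i
      by_contra! hle
      refine hy (Metric.mem_cthickening_of_dist_le y (p i) _ _ ?_ hle)
      exact AffineSubspace.mem_mk'.2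
        (hW (vsub_mem_vectorSpan ℝ (mem_range_self i) (mem_range_self 0)))
    refine ⟨Fin.cons y p, Fin.cases hyK hpK, Fin.cases hyx hpx, ?_⟩
    intro i i'
    refine Fin.cases ?_ (fun i => ?_) i <;> refine Fin.cases ?_ (fun i' => ?_) i'
    · exact fun hne => absurd rfl hne
    · exact fun _ => hfar i'
    · intro _
      simpa only [Fin.cons_succ, Fin.cons_zero, dist_comm] using hfar i
    · intro hne
      simpa only [Fin.cons_succ] using hp i i' fun hii' => hne (congrArg Fin.succ hii')

/-- Iterating a splitting of balls centred on `K` of radius at most `r` into `M` separated balls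
with contraction ratio `c`. -/
theorem exists_separated_pow {X : Type*} [MetricSpace X] {K : Set X} {M : ℕ} {c r : ℝ}
    (hc : 0 < c) (hc' : c ≤ 1)
    (h : ∀ x ∈ K, ∀ ρ : ℝ, 0 < ρ → ρ ≤ r → ∃ p : Fin M → X, (∀ i, p i ∈ K) ∧
      (∀ i, dist (p i) x ≤ (1 - c) * ρ) ∧ ∀ i i', i ≠ i' → 2 * c * ρ < dist (p i) (p i'))
    (n : ℕ) : ∀ x ∈ K, ∀ ρ : ℝ, 0 < ρ → ρ ≤ r → ∃ p : Fin (M ^ n) → X, (∀ i, p i ∈ K) ∧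
      (∀ i, dist (p i) x ≤ (1 - c ^ n) * ρ) ∧
      ∀ i i', i ≠ i' → 2 * c ^ n * ρ < dist (p i) (p i') := by
  induction n with
  | zero => exact fun x hx ρ _ _ => ⟨fun _ => x, fun _ => hx, fun _ => by simp,
      fun i i' hii' => absurd (Subsingleton.elim (α := Fin 1) i i') hii'⟩
  | succ n ih =>
    intro x hx ρ hρ hρr
    obtain ⟨q, hqK, hqx, hq⟩ := h x hx ρ hρ hρr
    have hcρ : c * ρ ≤ r := (mul_le_of_le_one_left hρ.le hc').trans hρr
    choose p hpK hpq hp using fun i => ih (q i) (hqK i) (c * ρ) (mul_pos hc hρ) hcρ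
    let e : Fin (M ^ (n + 1)) ≃ Fin (M ^ n) × Fin M :=
      (finCongr (pow_succ M n)).trans finProdFinEquiv.symm
    refine ⟨fun i => p (e i).2 (e i).1, fun i => hpK _ _, fun i => ?_, fun i i' hne => ?_⟩
    · have h₁ := hpq (e i).2 (e i).1
      have h₂ := hqx (e i).2
      have h₃ := dist_triangle (p (e i).2 (e i).1) (q (e i).2) x
      rw [pow_succ c]
      linarith
    · have hne' : e i ≠ e i' := e.injective.ne hne
      beta_reduce
      generalize e i = a at hne' ⊢
      generalize e i' = b at hne' ⊢
      obtain ⟨a₁, a₂⟩ := a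
      obtain ⟨b₁, b₂⟩ := b
      rw [pow_succ c]
      rcases eq_or_ne a₂ b₂ with rfl | hab
      · have := hp a₂ a₁ b₁ fun h => hne' (by rw [h])
        linarith
      -- Moving from the centres to the points loses at most `2 (1 - c ^ n) c ρ` of `2 c ρ`, leaving
      -- `2 c ^ (n + 1) ρ`.
      · have h₁ := hpq a₂ a₁
        have h₂ := hpq b₂ b₁
        have h₃ := hq a₂ b₂ hab
        have h₄ := dist_triangle4 (q a₂) (p a₂ a₁) (p b₂ b₁) (q b₂)
        rw [dist_comm (q a₂) (p a₂ a₁)] at h₄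
        dsimp only
        linarith

/-- In a diffuse set, small balls contain `(k + 2) ^ n` points of the set whose surrounding balls of
relative radius `(β / (2 + β)) ^ n` are disjoint and stay inside. -/
theorem IsDiffuse.exists_separated (hK : IsDiffuse k β K) :
    ∃ r : ℝ, 0 < r ∧ ∀ n : ℕ, ∀ x ∈ K, ∀ ρ : ℝ, 0 < ρ → ρ ≤ r →
      ∃ p : Fin ((k + 2) ^ n) → EuclideanSpace ℝ (Fin d), (∀ i, p i ∈ K) ∧
        (∀ i, dist (p i) x ≤ (1 - (β / (2 + β)) ^ n) * ρ) ∧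
        ∀ i i', i ≠ i' → 2 * (β / (2 + β)) ^ n * ρ < dist (p i) (p i') := by
  obtain ⟨r, hr, h⟩ := hK.exists_point
  have hβ := hK.pos
  have hc : 0 < β / (2 + β) := by positivity
  have hc' : β / (2 + β) < 1 := (div_lt_one (by positivity)).2 (by linarith)
  refine ⟨r, hr, fun n => exists_separated_pow hc hc'.le (fun x hx ρ hρ hρr => ?_) n⟩
  -- Diffuseness is used at radius `(1 - c) ρ` with `c = β / (2 + β)`, the solution of `β (1 - c) =
  -- 2 c`.
  have hρ' : 0 < (1 - β / (2 + β)) * ρ := mul_pos (sub_pos.2 hc') hρ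
  have hρr' : (1 - β / (2 + β)) * ρ ≤ r :=
    (mul_le_of_le_one_left hρ.le (by linarith)).trans hρr
  obtain ⟨p, hpK, hpx, hp⟩ := exists_separated_of_diffuse hK.dim_lt hρ'.le hx
    (h _ hρ' hρr' x hx) (le_refl (k + 1))
  refine ⟨p, hpK, hpx, fun i i' hne => ?_⟩
  convert hp i i' hne using 1
  field_simp
  ring

end Separated

/-! ### Plays of the game indexed by sequences of choices -/

namespace SchmidtGame

variable {d N : ℕ}

/-- The list of Bob's first `n + 1` balls when he starts with `B₀` and answers Alice's ball `A` in
round `i` by `next A (ω i)`. -/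
def bobHistory (σ : Strategy d) (B₀ : GameBall d) (next : GameBall d → Fin N → GameBall d)
    (ω : ℕ → Fin N) : ℕ → List (GameBall d)
  | 0 => [B₀]
  | n + 1 => bobHistory σ B₀ next ω n ++ [next (σ (bobHistory σ B₀ next ω n)) (ω n)]

/-- Bob's `n`-th ball in the play described by `bobHistory`. -/
def bobBall (σ : Strategy d) (B₀ : GameBall d) (next : GameBall d → Fin N → GameBall d)
    (ω : ℕ → Fin N) : ℕ → GameBall d
  | 0 => B₀
  | n + 1 => next (σ (bobHistory σ B₀ next ω n)) (ω n)

theorem map_bobBall_range (σ : Strategy d) (B₀ : GameBall d)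
    (next : GameBall d → Fin N → GameBall d) (ω : ℕ → Fin N) (n : ℕ) :
    (List.range (n + 1)).map (bobBall σ B₀ next ω) = bobHistory σ B₀ next ω n := by
  induction n with
  | zero => rfl
  | succ n ih =>
    rw [List.range_succ, List.map_append, ih]
    rfl

theorem bobBall_succ (σ : Strategy d) (B₀ : GameBall d)
    (next : GameBall d → Fin N → GameBall d) (ω : ℕ → Fin N) (n : ℕ) :
    bobBall σ B₀ next ω (n + 1) = next (aliceBall σ (bobBall σ B₀ next ω) n) (ω n) := by
  rw [aliceBall, map_bobBall_range]
  rfl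

/-- Later choices cannot influence the position, so two plays face the same ball of Alice at their
first difference; their separation is measured there. -/
theorem bobHistory_congr (σ : Strategy d) (B₀ : GameBall d)
    (next : GameBall d → Fin N → GameBall d) {u v : ℕ → Fin N} {n : ℕ}
    (h : ∀ i < n, u i = v i) : bobHistory σ B₀ next u n = bobHistory σ B₀ next v n := by
  induction n with
  | zero => rfl
  | succ n ih =>
    rw [bobHistory, bobHistory, ih fun i hi => h i (by omega), h n (by omega)]

variable {α γ r : ℝ} {S K U : Set (EuclideanSpace ℝ (Fin d))}

/-- If every small ball centred on the closed set `K` contains `N` points of `K` around which Bob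
can place balls of relative radius `γ` at mutual distance at least `2 γ`, then a set that is
`(α, γ)`-winning on `K` has dimension at least `log N / -log (α γ)` in every open set that
meets `K`. -/
theorem IsWinningOnWith.le_dimH (hα : 0 < α) (hα' : α < 1) (hγ : 0 < γ) (hγ' : γ < 1)
    (hN : 1 < N) (hKc : IsClosed K) (hr : 0 < r)
    (hsep : ∀ x ∈ K, ∀ ρ : ℝ, 0 < ρ → ρ ≤ r →
      ∃ p : Fin N → EuclideanSpace ℝ (Fin d), (∀ i, p i ∈ K) ∧
        (∀ i, dist (p i) x ≤ (1 - γ) * ρ) ∧ ∀ i i', i ≠ i' → 4 * γ * ρ ≤ dist (p i) (p i'))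
    (hS : IsWinningOnWith α γ S K) (hU : IsOpen U) (hUK : (U ∩ K).Nonempty) :
    ENNReal.ofReal (Real.log N / -Real.log (α * γ)) ≤ dimH (S ∩ K ∩ U) := by
  obtain ⟨σ, hσ⟩ := hS
  obtain ⟨x₀, hx₀U, hx₀K⟩ := hUK
  obtain ⟨R', hR', hR'U⟩ := Metric.nhds_basis_closedBall.mem_iff.1 (hU.mem_nhds hx₀U)
  obtain ⟨R, hR, hRr, hRR'⟩ : ∃ R, 0 < R ∧ R ≤ r ∧ R ≤ R' :=
    ⟨min r R', lt_min hr hR', min_le_left _ _, min_le_right _ _⟩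
  have hsep' : ∀ A : GameBall d, ∃ p : Fin N → EuclideanSpace ℝ (Fin d),
      A.center ∈ K → 0 < A.radius → A.radius ≤ r → (∀ i, p i ∈ K) ∧
        (∀ i, dist (p i) A.center ≤ (1 - γ) * A.radius) ∧
        ∀ i i', i ≠ i' → 4 * γ * A.radius ≤ dist (p i) (p i') := by
    intro A
    by_cases hA : A.center ∈ K ∧ 0 < A.radius ∧ A.radius ≤ r
    · obtain ⟨p, hp⟩ := hsep A.center hA.1 A.radius hA.2.1 hA.2.2
      exact ⟨p, fun _ _ _ => hp⟩
    -- Junk value, making `next` total; legal plays never reach it.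
    · exact ⟨fun _ => 0, fun h₁ h₂ h₃ => absurd ⟨h₁, h₂, h₃⟩ hA⟩
  choose P hP using hsep'
  let next : GameBall d → Fin N → GameBall d := fun A i => ⟨P A i, γ * A.radius⟩
  let b : (ℕ → Fin N) → ℕ → GameBall d := bobBall σ ⟨x₀, R⟩ next
  have hθ : 0 < α * γ := mul_pos hα hγ
  have hθ' : α * γ < 1 := mul_lt_one_of_nonneg_of_lt_one_left hα.le hα' hγ'.le
  have hbsucc : ∀ ω n, b ω (n + 1) = next (aliceBall σ (b ω) n) (ω n) :=
    fun ω n => bobBall_succ σ _ next ω n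
  have hsmall : ∀ n : ℕ, R * (α * γ) ^ n ≤ r := fun n =>
    (mul_le_of_le_one_right hR.le (pow_le_one₀ hθ.le hθ'.le)).trans hRr
  have hplay : ∀ ω n, (∀ i ≤ n, BobLegal K γ σ (b ω) i) ∧ (b ω n).radius = R * (α * γ) ^ n := by
    intro ω n
    induction n with
    | zero =>
      refine ⟨fun i hi => ?_, by simp [b, bobBall]⟩
      obtain rfl : i = 0 := by omega
      exact ⟨hx₀K, hR⟩
    | succ n ih =>
      obtain ⟨hA, hAr, -⟩ := (hσ (b ω)).1 n ih.1
      rw [ih.2] at hAr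
      have hA0 : 0 < (aliceBall σ (b ω) n).radius := by rw [hAr]; positivity
      have hA1 : (aliceBall σ (b ω) n).radius ≤ r := by
        rw [hAr]
        exact (mul_le_of_le_one_left (by positivity) hα'.le).trans (hsmall n)
      obtain ⟨hPK, hPx, -⟩ := hP _ hA hA0 hA1
      refine ⟨fun i hi => ?_, ?_⟩
      · rcases Nat.lt_or_ge n i with hni | hni
        · obtain rfl : i = n + 1 := by omega
          refine ⟨?_, ?_, ?_⟩
          · rw [hbsucc]
            exact hPK _
          · rw [hbsucc]
          · rw [hbsucc]
            refine Metric.closedBall_subset_closedBall' ?_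
            have := hPx (ω n)
            change γ * _ + dist (P _ _) _ ≤ _
            linarith
        · exact ih.1 i hni
      · rw [hbsucc]
        change γ * (aliceBall σ (b ω) n).radius = _
        rw [hAr, pow_succ]
        ring
  have hlegal : ∀ ω n, BobLegal K γ σ (b ω) n := fun ω n => (hplay ω n).1 n le_rfl
  have hcenter : ∀ ω n, (b ω n).center ∈ K := by
    intro ω n
    cases n with
    | zero => exact hx₀K
    | succ n => exact (hlegal ω (n + 1)).1
  choose x hxS hx using fun ω => (hσ (b ω)).2 (hlegal ω)
  have hxb : ∀ ω n, dist (x ω) (b ω n).center ≤ R * (α * γ) ^ n := by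
    intro ω n
    have h : x ω ∈ ⋂ n, (b ω n).toSet := by rw [hx]; rfl
    rw [← (hplay ω n).2]
    exact mem_iInter.1 h n
  have hlim : Tendsto (fun n : ℕ => R * (α * γ) ^ n) atTop (𝓝 0) := by
    simpa using (tendsto_pow_atTop_nhds_zero_of_lt_one hθ.le hθ').const_mul R
  have hxK : ∀ ω, x ω ∈ K := fun ω =>
    hKc.mem_of_tendsto (tendsto_iff_dist_tendsto_zero.2
      (squeeze_zero (fun _ => dist_nonneg) (fun n => by rw [dist_comm]; exact hxb ω n) hlim))
      (Eventually.of_forall (hcenter ω))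
  have hxU : ∀ ω, x ω ∈ U := fun ω => hR'U <| by
    have := hxb ω 0
    rw [pow_zero, mul_one] at this
    exact Metric.mem_closedBall.2 (this.trans hRR')
  -- At a first difference in round `n` the next centres are `4 R (αγ) ^ (n + 1)` apart, and each
  -- outcome lies within `R (αγ) ^ (n + 1)` of its centre.
  refine (le_dimH_range_of_separated (c := 2 * R * (α * γ)) hN hθ hθ' (by positivity) x ?_).trans
    (dimH_mono (range_subset_iff.2 fun ω => ⟨⟨hxS ω, hxK ω⟩, hxU ω⟩))
  intro u v n huv hne
  have hAA : aliceBall σ (b v) n = aliceBall σ (b u) n := by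
    simp only [aliceBall, b, map_bobBall_range, bobHistory_congr σ _ next huv]
  obtain ⟨hA, hAr, -⟩ := (hσ (b u)).1 n (hplay u n).1
  rw [(hplay u n).2] at hAr
  have hA0 : 0 < (aliceBall σ (b u) n).radius := by rw [hAr]; positivity
  have hA1 : (aliceBall σ (b u) n).radius ≤ r := by
    rw [hAr]
    exact (mul_le_of_le_one_left (by positivity) hα'.le).trans (hsmall n)
  have h₁ := (hP _ hA hA0 hA1).2.2 (u n) (v n) hne
  have h₂ := hxb u (n + 1)
  have h₃ := hxb v (n + 1)
  rw [hbsucc] at h₂ h₃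
  rw [hAA] at h₃
  change dist _ (P _ _) ≤ _ at h₂ h₃
  have h₄ := dist_triangle4 (P (aliceBall σ (b u) n) (u n)) (x u) (x v)
    (P (aliceBall σ (b u) n) (v n))
  rw [dist_comm _ (x u)] at h₄
  rw [hAr] at h₁
  rw [pow_succ] at h₂ h₃
  linarith

end SchmidtGame

/-! ### Conclusion: many scales per move -/

theorem theorem4p6 {d k : ℕ} {β : ℝ} {K S U : Set (EuclideanSpace ℝ (Fin d))}
    (hK : IsDiffuse k β K) (hS : SchmidtGame.IsWinningOn S K)
    (hU : IsOpen U) (hUK : (U ∩ K).Nonempty) :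
    ENNReal.ofReal (-Real.log ((k : ℝ) + 2) / (Real.log β - Real.log (2 + β))) ≤
      dimH (S ∩ K ∩ U) := by
  obtain ⟨α, hα, hα', hwin⟩ := hS
  obtain ⟨r, hr, hsep⟩ := hK.exists_separated
  have hβ := hK.pos
  have hc : 0 < β / (2 + β) := by positivity
  have hc' : β / (2 + β) < 1 := (div_lt_one (by positivity)).2 (by linarith)
  rw [← Real.log_div (by positivity) (by positivity)]
  generalize β / (2 + β) = c at hc hc' hsep
  have hlogc : Real.log c < 0 := Real.log_neg hc hc'
  have hbound : ∀ n : ℕ, 1 ≤ n →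
      ENNReal.ofReal (Real.log ((k : ℝ) + 2) / (-Real.log c + -Real.log (α / 2) / n)) ≤
        dimH (S ∩ K ∩ U) := by
    intro n hn
    have hn' : (0 : ℝ) < n := by exact_mod_cast hn
    have hcn : 0 < c ^ n := by positivity
    have hcn' : c ^ n ≤ 1 := pow_le_one₀ hc.le hc'.le
    -- Halving `c ^ n` turns the separation `2 c ^ n ρ` into the required `4 γ ρ`; the factor `1 /
    -- 2` is absorbed into `α / 2`.
    have h := (hwin (c ^ n / 2) (by positivity) (by linarith)).le_dimH (N := (k + 2) ^ n) hα hα'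
      (by positivity) (by linarith) (Nat.one_lt_pow (by omega) (by omega)) hK.isClosed hr
      (fun x hx ρ hρ hρr => ?_) hU hUK
    · convert h using 2
      have hlog : Real.log (α * (c ^ n / 2)) = n * Real.log c + Real.log (α / 2) := by
        rw [← Real.log_pow, ← Real.log_mul hcn.ne' (by positivity)]
        congr 1
        ring
      rw [hlog]
      push_cast
      rw [Real.log_pow, ← mul_div_mul_left _ _ hn'.ne']
      congr 1
      field_simp
      ring
    · obtain ⟨p, hpK, hpx, hp⟩ := hsep n x hx ρ hρ hρr
      refine ⟨p, hpK, fun i => (hpx i).trans ?_, fun i i' hne => ?_⟩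
      · gcongr
        linarith
      · have := hp i i' hne
        linarith
  have hlim : Tendsto
      (fun n : ℕ => Real.log ((k : ℝ) + 2) / (-Real.log c + -Real.log (α / 2) / n)) atTop
      (𝓝 (-Real.log ((k : ℝ) + 2) / Real.log c)) := by
    have h := (tendsto_const_nhds (x := Real.log ((k : ℝ) + 2))).div
      ((tendsto_const_nhds (x := -Real.log c)).add
        (tendsto_const_div_atTop_nhds_zero_nat (-Real.log (α / 2))))
      (by rw [add_zero]; exact (neg_pos.2 hlogc).ne')
    rwa [add_zero, div_neg, ← neg_div] at h
  exact le_of_tendsto (ENNReal.tendsto_ofReal hlim) (eventually_atTop.2 ⟨1, hbound⟩)
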